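/- \textbf{Proposition (Existence and uniqueness for a variational inequality).} Let $K\subset\mathbb{R}^m$ be nonempty, closed and convex. For $G:K\to\mathbb{R}^m$, a solution of $\operatorname{VI}(G,K)$ is a point $y\in K$ such that $(v-y)^T G(y)\ge 0$ for all $v\in K$. Call $G$ \emph{strictly monotone} on $K$ if $(u-v)^T(G(u)-G(v))>0$ for all $u,v\in K$ with $u\ne v$, and \emph{strongly monotone} on $K$ if there is a constant $c>0$ such that $(u-v)^T(G(u)-G(v))\ge c\|u-v\|^2$ for all $u,v\in K$, where $\|\cdot\|$ is the Euclidean norm. (1) If $K$ is compact and $G:K\to\mathbb{R}^m$ is continuous, then $\operatorname{VI}(G,K)$ has a solution. (2) If $K$ is compact and $G:K\to\mathbb{R}^m$ is continuous and strictly monotone on $K$, then $\operatorname{VI}(G,K)$ has exactly one solution. (3) If $G:K\to\mathbb{R}^m$ is continuous and strongly monotone on $K$ (where $K$ may be unbounded), then $\operatorname{VI}(G,K)$ has exactly one solution. (4) If $K$ is unbounded, then continuity of $G$ alone does not suffice for existence: there is a continuous $G:K\to\mathbb{R}^m$ such that $\operatorname{VI}(G,K)$ has no solution. -/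

import Mathlib

namespace VI

/-- The solution set of the variational inequality `VI(G, K)` in `ℝᵐ`: the points `y ∈ K` such that
`(v - y)ᵀ G(y) ≥ 0` for all `v ∈ K`. Only the values of `G` on `K` matter. -/
def solutionSet {m : ℕ} (G : EuclideanSpace ℝ (Fin m) → EuclideanSpace ℝ (Fin m))
    (K : Set (EuclideanSpace ℝ (Fin m))) : Set (EuclideanSpace ℝ (Fin m)) :=
  {y | y ∈ K ∧ ∀ v ∈ K, 0 ≤ inner ℝ (v - y) (G y)}

/-- `G` is strictly monotone on `K`: `(u - v)ᵀ (G(u) - G(v)) > 0` for all `u ≠ v` in `K`. -/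
def StrictlyMonotoneOn {m : ℕ} (G : EuclideanSpace ℝ (Fin m) → EuclideanSpace ℝ (Fin m))
    (K : Set (EuclideanSpace ℝ (Fin m))) : Prop :=
  ∀ u ∈ K, ∀ v ∈ K, u ≠ v → 0 < inner ℝ (u - v) (G u - G v)

/-- `G` is strongly monotone on `K`: for some `c > 0`,
`(u - v)ᵀ (G(u) - G(v)) ≥ c ‖u - v‖²` for all `u, v ∈ K`. -/
def StronglyMonotoneOn {m : ℕ} (G : EuclideanSpace ℝ (Fin m) → EuclideanSpace ℝ (Fin m))
    (K : Set (EuclideanSpace ℝ (Fin m))) : Prop :=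
  ∃ c : ℝ, 0 < c ∧ ∀ u ∈ K, ∀ v ∈ K, c * ‖u - v‖ ^ 2 ≤ inner ℝ (u - v) (G u - G v)

end VI

/-! If `P` is the nearest-point projection onto `K`, a fixed point of `y ↦ P (y - G y)` solves the
inequality, so compact `K` reduces to Brouwer's theorem.

Brouwer is proved by integrating Jacobians. After smoothing, a fixed-point-free map yields a C¹
retraction `r` of a ball onto its sphere. Put `h = r - id`. For small `t ≥ 0`, `id + t h` permutes
the open ball, so `∫ det (1 + t h')` is its volume. The integrand is polynomial in `t`, so this
persists at `t = 1`, where `det r' = 0`: a contradiction.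

Two solutions tested against each other contradict strict monotonicity. Strong monotonicity keeps
the solution on a large truncation of `K` off the truncating sphere. If every constant `G` had a
solution, each coordinate would be bounded on `K`. -/

section BrouwerFixedPoint

/-! ### Small perturbations of the identity -/

open MeasureTheory Set
open scoped NNReal

/-- The determinant of `1 + t A` is a polynomial in `t` of degree at most the dimension. -/
theorem exists_polynomial_eval_eq_det_one_add_smul {E : Type*} [NormedAddCommGroup E]
    [NormedSpace ℝ E] [FiniteDimensional ℝ E] (A : E →L[ℝ] E) :
    ∃ p : Polynomial ℝ, p.natDegree ≤ Module.finrank ℝ E ∧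
      ∀ t : ℝ, p.eval t = (1 + t • A).det := by
  classical
  let b := Module.finBasis ℝ E
  let M := LinearMap.toMatrix b b (A : E →ₗ[ℝ] E)
  refine ⟨Matrix.det ((Polynomial.X : Polynomial ℝ) • M.map Polynomial.C +
    (1 : Matrix _ _ ℝ).map Polynomial.C), ?_, fun t => ?_⟩
  · simpa using Polynomial.natDegree_det_X_add_C_le M 1
  · have h : LinearMap.toMatrix b b ((1 + t • A : E →L[ℝ] E) : E →ₗ[ℝ] E) = 1 + t • M := by
      rw [ContinuousLinearMap.toLinearMap_add, ContinuousLinearMap.toLinearMap_smul, map_add, map_smul,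
        ContinuousLinearMap.toLinearMap_one, LinearMap.toMatrix_one]
    rw [ContinuousLinearMap.det, ← LinearMap.det_toMatrix b, h, ← Polynomial.coe_evalRingHom,
      RingHom.map_det]
    congr 1
    ext i j
    by_cases hij : i = j <;> simp [hij, add_comm] <;> exact mul_comm _ _

/-- A perturbation of the identity by an operator of norm less than one has positive
determinant. -/
theorem det_one_add_pos_of_norm_lt_one {E : Type*} [NormedAddCommGroup E]
    [NormedSpace ℝ E] [FiniteDimensional ℝ E] {A : E →L[ℝ] E} (hA : ‖A‖ < 1) :
    0 < (1 + A).det := by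
  obtain ⟨p, -, hp⟩ := exists_polynomial_eval_eq_det_one_add_smul A
  -- `v = -s A v` with `‖s A‖ < 1` forces `v = 0`, so the determinant keeps its sign along the
  -- segment from `1` to `1 + A`.
  have hne : ∀ s ∈ Icc (0 : ℝ) 1, p.eval s ≠ 0 := by
    intro s hs h0
    rw [hp, ContinuousLinearMap.det] at h0
    obtain ⟨v, hv, hv0⟩ := (Submodule.ne_bot_iff _).1 (LinearMap.bot_lt_ker_of_det_eq_zero h0).ne'
    have h1 : v + s • A v = 0 := by simpa using hv
    have h2 : ‖v‖ ≤ ‖A‖ * ‖v‖ := by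
      calc ‖v‖ = s * ‖A v‖ := by
            conv_lhs => rw [eq_neg_of_add_eq_zero_left h1, norm_neg, norm_smul,
              Real.norm_of_nonneg hs.1]
        _ ≤ 1 * ‖A v‖ := by gcongr; exact hs.2
        _ ≤ ‖A‖ * ‖v‖ := by rw [one_mul]; exact A.le_opNorm v
    nlinarith [norm_pos_iff.2 hv0]
  have h0 : p.eval 0 = 1 := by rw [hp]; simp [ContinuousLinearMap.det]
  have h1 : p.eval 1 = (1 + A).det := by rw [hp, one_smul]
  rw [← h1]
  by_contra! hle
  obtain ⟨s, hs, hs0⟩ := intermediate_value_Icc' zero_le_one p.continuous.continuousOn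
    (show (0 : ℝ) ∈ Icc (p.eval 1) (p.eval 0) from ⟨hle, by rw [h0]; exact zero_le_one⟩)
  exact hne s hs hs0

/-- A contraction perturbing the identity only inside `U` maps `U` bijectively onto itself. -/
theorem bijOn_id_add_of_lipschitzWith {E : Type*} [NormedAddCommGroup E] [CompleteSpace E]
    {h : E → E} {U : Set E} {K : ℝ≥0} (hK : K < 1) (hL : LipschitzWith K h) (h0 : ∀ x ∉ U, h x = 0) :
    BijOn (fun x => x + h x) U U := by
  have hinj : Function.Injective (fun x => x + h x) := by
    intro x y hxy
    have h1 : x - y = h y - h x := by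
      rw [sub_eq_sub_iff_add_eq_add]
      rw [add_comm (h y)]
      exact hxy
    have h2 : ‖x - y‖ ≤ K * ‖x - y‖ := by
      calc ‖x - y‖ = ‖h y - h x‖ := by rw [h1]
        _ ≤ K * ‖y - x‖ := hL.norm_sub_le y x
        _ = K * ‖x - y‖ := by rw [norm_sub_rev]
    have h3 : (K : ℝ) < 1 := by exact_mod_cast hK
    have h4 := norm_nonneg (x - y)
    exact sub_eq_zero.1 (norm_eq_zero.1 (by nlinarith))
  refine ⟨fun x hx => ?_, hinj.injOn, fun y hy => ?_⟩
  · by_contra hz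
    -- If `x + h x` left `U` it would be a fixed point with the same image as `x`, hence equal to
    -- `x`.
    have h1 : (fun x => x + h x) (x + h x) = (fun x => x + h x) x := by
      simp [h0 _ hz]
    exact hz (Set.mem_of_eq_of_mem (hinj h1) hx)
  · have hc : ContractingWith K (fun x => y - h x) :=
      ⟨hK, LipschitzWith.of_dist_le_mul fun a b => by
        rw [dist_sub_left]; exact hL.dist_le_mul a b⟩
    have hfix : y - h (hc.fixedPoint _) = hc.fixedPoint _ := hc.fixedPoint_isFixedPt
    have hy' : hc.fixedPoint _ + h (hc.fixedPoint _) = y := by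
      nth_rewrite 1 [← hfix]; simp
    refine ⟨_, ?_, hy'⟩
    by_contra hz
    rw [h0 _ hz, add_zero] at hy'
    exact hz (by rwa [hy'])

/-! ### Integrals of Jacobians -/

section Perturbation

variable {E : Type*} [NormedAddCommGroup E] [NormedSpace ℝ E] [FiniteDimensional ℝ E]
  [MeasurableSpace E] [BorelSpace E]

/-- Integrals of Jacobians of contractive perturbations of the identity supported in `U`. -/
theorem integral_det_one_add_of_contraction (μ : Measure E) [μ.IsAddHaarMeasure]
    {h : E → E} {h' : E → E →L[ℝ] E} {U : Set E} {K : ℝ≥0} (hU : IsOpen U) (hμ : μ U ≠ ⊤)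
    (hK : K < 1) (hL : LipschitzWith K h) (h0 : ∀ x ∉ U, h x = 0)
    (hd : ∀ x ∈ U, HasFDerivAt h (h' x) x) :
    IntegrableOn (fun x => (1 + h' x).det) U μ ∧ ∫ x in U, (1 + h' x).det ∂μ = μ.real U := by
  have hb := bijOn_id_add_of_lipschitzWith hK hL h0
  have hd' : ∀ x ∈ U, HasFDerivWithinAt (fun x => x + h x) (1 + h' x) U x := fun x hx =>
    ((hasFDerivAt_id x).add (hd x hx)).hasFDerivWithinAt
  have hpos : ∀ x ∈ U, |(1 + h' x).det| • (1 : ℝ) = (1 + h' x).det := fun x hx => by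
    have : ‖h' x‖ ≤ K := (hd x hx).le_of_lipschitz hL
    rw [abs_of_pos (det_one_add_pos_of_norm_lt_one (this.trans_lt (by exact_mod_cast hK))),
      smul_eq_mul, mul_one]
  have hi := (integrableOn_image_iff_integrableOn_abs_det_fderiv_smul μ hU.measurableSet hd'
    hb.injOn (fun _ => (1 : ℝ))).1 (by
      rw [hb.image_eq]; exact integrableOn_const hμ)
  refine ⟨(integrableOn_congr_fun hpos hU.measurableSet).1 hi, ?_⟩
  have he := integral_image_eq_integral_abs_det_fderiv_smul μ hU.measurableSet hd'
    hb.injOn (fun _ => (1 : ℝ))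
  rw [hb.image_eq, setIntegral_congr_fun hU.measurableSet hpos] at he
  rw [← he]; simp

/-- The Jacobian of a Lipschitz perturbation of the identity supported in an open set `U` of
finite measure integrates to the measure of `U`. -/
theorem integral_det_one_add_of_lipschitzWith (μ : Measure E) [μ.IsAddHaarMeasure]
    {h : E → E} {h' : E → E →L[ℝ] E} {U : Set E} {K : ℝ≥0} (hU : IsOpen U) (hμ : μ U ≠ ⊤)
    (hL : LipschitzWith K h) (h0 : ∀ x ∉ U, h x = 0)
    (hd : ∀ x ∈ U, HasFDerivAt h (h' x) x) :
    ∫ x in U, (1 + h' x).det ∂μ = μ.real U := by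
  classical
  let n := Module.finrank ℝ E
  let s := Finset.range (n + 1)
  -- Distinct nodes with `v i * K < 1`; `n + 1` of them determine a polynomial of degree at most
  -- `n`.
  let v : ℕ → ℝ := fun i => ((K : ℝ) + 1)⁻¹ * ((i : ℝ) + 1)⁻¹
  have hv : InjOn v s := by
    intro i _ j _ hij
    have : ((K : ℝ) + 1)⁻¹ ≠ 0 := by positivity
    have := inv_injective (mul_left_cancel₀ this hij)
    exact_mod_cast add_right_cancel this
  have key : ∀ i, IntegrableOn (fun x => (1 + v i • h' x).det) U μ ∧
      ∫ x in U, (1 + v i • h' x).det ∂μ = μ.real U := by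
    intro i
    have hv0 : 0 ≤ v i := by positivity
    refine integral_det_one_add_of_contraction μ (h := v i • h) (h' := fun x => v i • h' x)
      (K := ‖v i‖₊ * K) hU hμ ?_ ?_ (fun x hx => by simp [h0 x hx])
      (fun x hx => (hd x hx).const_smul _)
    · rw [← NNReal.coe_lt_coe]
      push_cast
      rw [Real.norm_of_nonneg hv0]
      have h1 : ((i : ℝ) + 1)⁻¹ ≤ 1 := inv_le_one_of_one_le₀ (by simp)
      calc v i * K ≤ ((K : ℝ) + 1)⁻¹ * 1 * K := by simp only [v]; gcongr
        _ < 1 := by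
          rw [mul_one, inv_mul_lt_iff₀ (by positivity)]; simp
    · refine LipschitzWith.of_dist_le_mul fun a b => ?_
      rw [Pi.smul_apply, Pi.smul_apply, dist_smul₀, NNReal.coe_mul, coe_nnnorm, mul_assoc]
      gcongr
      exact hL.dist_le_mul a b
  -- Weights extrapolating from the nodes to `t = 1`.
  let w : ℕ → ℝ := fun i => (Lagrange.basis s v i).eval 1
  have hsum : ∑ i ∈ s, w i = 1 := by
    have := congrArg (Polynomial.eval 1) (Lagrange.sum_basis hv (by simp [s]))
    simpa [Polynomial.eval_finsetSum] using this
  have hdet : ∀ x, (1 + h' x).det = ∑ i ∈ s, w i * (1 + v i • h' x).det := by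
    intro x
    obtain ⟨p, hdeg, hp⟩ := exists_polynomial_eval_eq_det_one_add_smul (h' x)
    have hlt : p.degree < (s.card : WithBot ℕ) := by
      rw [Finset.card_range]
      exact (Polynomial.degree_le_of_natDegree_le hdeg).trans_lt (by exact_mod_cast Nat.lt_succ_self n)
    have := congrArg (Polynomial.eval 1) (Lagrange.eq_interpolate hv hlt)
    rw [hp, one_smul, Lagrange.interpolate_apply] at this
    rw [this]
    simp [Polynomial.eval_finsetSum, hp, w, mul_comm]
  simp_rw [hdet]
  rw [integral_finsetSum _ fun i _ => (key i).1.const_mul _]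
  simp_rw [integral_const_mul, (key _).2, ← Finset.sum_mul, hsum, one_mul]

end Perturbation

/-! ### Metric projection -/

/-- The metric projection onto a nonempty closed convex set, characterized by its variational
inequality, is nonexpansive. -/
theorem exists_lipschitzWith_one_projection {E : Type*} [NormedAddCommGroup E]
    [InnerProductSpace ℝ E] [CompleteSpace E] {K : Set E} (hne : K.Nonempty) (hK : IsClosed K)
    (hc : Convex ℝ K) :
    ∃ P : E → E, LipschitzWith 1 P ∧ (∀ x, P x ∈ K) ∧ (∀ x ∈ K, P x = x) ∧
      ∀ x, ∀ v ∈ K, inner ℝ (x - P x) (v - P x) ≤ 0 := by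
  choose P hPK hP using exists_norm_eq_iInf_of_complete_convex hne hK.isComplete hc
  have hvi : ∀ x, ∀ v ∈ K, inner ℝ (x - P x) (v - P x) ≤ 0 := fun x =>
    (norm_eq_iInf_iff_real_inner_le_zero hc (hPK x)).1 (hP x)
  refine ⟨P, LipschitzWith.of_dist_le_mul fun x y => ?_, hPK, fun x hx => ?_, hvi⟩
  · have h1 := hvi x (P y) (hPK y)
    have h2 := hvi y (P x) (hPK x)
    have h3 : ‖P x - P y‖ ^ 2 ≤ inner ℝ (x - y) (P x - P y) := by
      rw [← real_inner_self_eq_norm_sq]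
      simp only [inner_sub_left, inner_sub_right] at h1 h2 ⊢
      linarith
    have h4 := real_inner_le_norm (x - y) (P x - P y)
    rw [dist_eq_norm, dist_eq_norm, NNReal.coe_one, one_mul]
    by_contra! hlt
    nlinarith [norm_nonneg (x - y)]
  · have h := hvi x x hx
    exact (sub_eq_zero.1 (real_inner_self_nonpos.1 h)).symm

/-- A point whose foot in `K` satisfies the variational inequality of the projection and lies in
the interior of `K` coincides with its foot. -/
theorem eq_of_mem_interior_of_inner_nonpos {E : Type*} [NormedAddCommGroup E]
    [InnerProductSpace ℝ E] {K : Set E} {x p : E} (hp : p ∈ interior K)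
    (h : ∀ v ∈ K, inner ℝ (x - p) (v - p) ≤ 0) : p = x := by
  have hcont : Filter.Tendsto (fun s : ℝ => p + s • (x - p)) (nhdsWithin 0 (Ioi 0)) (nhds p) := by
    have : Continuous fun s : ℝ => p + s • (x - p) := by fun_prop
    simpa using (this.tendsto 0).mono_left nhdsWithin_le_nhds
  obtain ⟨s, hs, hs0⟩ := ((hcont.eventually (mem_interior_iff_mem_nhds.1 hp)).and
    self_mem_nhdsWithin).exists
  have h1 := h _ hs
  rw [add_sub_cancel_left, inner_smul_right] at h1
  have h2 : inner ℝ (x - p) (x - p) ≤ 0 := by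
    by_contra! hlt
    exact absurd h1 (not_le.2 (mul_pos hs0 hlt))
  exact (sub_eq_zero.1 (real_inner_self_nonpos.1 h2)).symm

/-! ### No-retraction theorem and Brouwer's theorem -/

section Brouwer

variable {E : Type*} [NormedAddCommGroup E] [InnerProductSpace ℝ E] [FiniteDimensional ℝ E]

/-- A map of constant nonzero norm near a point has singular derivative there. -/
theorem det_eq_zero_of_eventually_norm_eq {r : E → E} {r' : E →L[ℝ] E} {x : E} {R : ℝ}
    (hR : R ≠ 0) (hr : HasFDerivAt r r' x) (hn : ∀ᶠ y in nhds x, ‖r y‖ = R) : r'.det = 0 := by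
  by_contra hdet
  have hsurj : Function.Surjective r' := by
    exact (LinearMap.equivOfDetNeZero (r' : E →ₗ[ℝ] E) hdet).surjective
  obtain ⟨v, hv⟩ := hsurj (r x)
  -- Differentiating the constant `‖r‖ ^ 2` along `v`, where `r' v = r x`, gives `2 ‖r x‖ ^ 2 = 0`.
  have h1 : HasFDerivAt (fun y => ‖r y‖ ^ 2) (0 : E →L[ℝ] ℝ) x :=
    (hasFDerivAt_const (R ^ 2) x).congr_of_eventuallyEq (hn.mono fun y hy => by simp [hy])
  have h2 := congrArg (fun L : E →L[ℝ] ℝ => L v) (hr.norm_sq.unique h1)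
  simp [hv] at h2
  have := hn.self_of_nhds
  rw [h2, norm_zero] at this
  exact hR this.symm

/-- There is no continuously differentiable retraction of a closed ball onto its sphere. -/
theorem not_contDiffOn_retraction_sphere {R : ℝ} (hR : 0 < R) {r : E → E}
    (hr : ContDiffOn ℝ 1 r (Metric.closedBall 0 R))
    (hn : ∀ x ∈ Metric.closedBall (0 : E) R, ‖r x‖ = R) :
    ¬ ∀ x ∈ Metric.sphere (0 : E) R, r x = x := by
  intro hs
  let : MeasurableSpace E := borel E
  have : BorelSpace E := ⟨rfl⟩
  obtain ⟨L, hL⟩ := hr.exists_lipschitzOnWith one_ne_zero (convex_closedBall 0 R)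
    (isCompact_closedBall 0 R)
  obtain ⟨P, hPL, hPK, hPid, hPvi⟩ := exists_lipschitzWith_one_projection
    (Metric.nonempty_closedBall.2 hR.le) Metric.isClosed_closedBall (convex_closedBall (0 : E) R)
  have hrP : LipschitzWith (L * 1) (fun x => r (P x)) :=
    lipschitzOnWith_univ.1 (hL.comp hPL.lipschitzOnWith fun x _ => hPK x)
  -- Composing with `P` makes the perturbation globally Lipschitz; it vanishes off the ball because
  -- `P x` is then on the sphere, which `r` fixes.
  have hh : LipschitzWith (L * 1 + 1) (fun x => r (P x) - P x) := hrP.sub hPL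
  have h0 : ∀ x ∉ Metric.ball (0 : E) R, r (P x) - P x = 0 := by
    intro x hx
    refine sub_eq_zero.2 (hs _ ?_)
    have h1 := hPK x
    rw [mem_sphere_zero_iff_norm]
    rw [mem_closedBall_zero_iff] at h1
    refine h1.antisymm (le_of_not_gt fun hlt => hx ?_)
    have h2 : P x ∈ Metric.ball (0 : E) R := mem_ball_zero_iff.2 hlt
    rwa [eq_of_mem_interior_of_inner_nonpos
      (interior_maximal Metric.ball_subset_closedBall Metric.isOpen_ball h2) (hPvi x)] at h2
  have hball : ∀ x ∈ Metric.ball (0 : E) R, Metric.closedBall (0 : E) R ∈ nhds x := fun x hx =>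
    Filter.mem_of_superset (Metric.isOpen_ball.mem_nhds hx) Metric.ball_subset_closedBall
  have hd : ∀ x ∈ Metric.ball (0 : E) R, HasFDerivAt r (fderiv ℝ r x) x := fun x hx =>
    ((hr.contDiffAt (hball x hx)).differentiableAt one_ne_zero).hasFDerivAt
  have hdh : ∀ x ∈ Metric.ball (0 : E) R,
      HasFDerivAt (fun x => r (P x) - P x) (fderiv ℝ r x - 1) x := fun x hx =>
    ((hd x hx).sub (hasFDerivAt_id x)).congr_of_eventuallyEq
      (Filter.mem_of_superset (hball x hx) fun y hy => by
        change r (P y) - P y = r y - y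
        rw [hPid y hy])
  have hint := integral_det_one_add_of_lipschitzWith (Measure.addHaar : Measure E)
    Metric.isOpen_ball Metric.isBounded_ball.measure_lt_top.ne hh h0 hdh
  have hzero : ∀ x ∈ Metric.ball (0 : E) R, (1 + (fderiv ℝ r x - 1)).det = 0 := fun x hx => by
    rw [add_sub_cancel]
    exact det_eq_zero_of_eventually_norm_eq hR.ne' (hd x hx)
      (Filter.mem_of_superset (hball x hx) hn)
  rw [setIntegral_congr_fun measurableSet_ball hzero, integral_zero] at hint
  have hpos : 0 < (Measure.addHaar : Measure E).real (Metric.ball (0 : E) R) :=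
    ENNReal.toReal_pos (Metric.measure_ball_pos _ _ hR).ne'
      Metric.isBounded_ball.measure_lt_top.ne
  exact hpos.ne hint

/-- Brouwer's fixed point theorem for continuously differentiable maps into a ball. -/
theorem exists_fixedPoint_of_contDiff_of_norm_le {R : ℝ} (hR : 0 < R) {f : E → E}
    (hf : ContDiff ℝ 1 f) (hfR : ∀ x, ‖f x‖ ≤ R) : ∃ x, f x = x := by
  by_contra! hne
  let u : E → E := fun x => x - f x
  have hu : ContDiff ℝ 1 u := contDiff_id.sub hf
  have hu0 : ∀ x, 0 < ‖u x‖ ^ 2 := fun x =>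
    pow_pos (norm_pos_iff.2 (sub_ne_zero.2 (hne x).symm)) 2
  -- `l x` is the larger root of `‖x + l • u x‖ ^ 2 = R ^ 2`, and `D x` a quarter of its
  -- discriminant: `x` is pushed away from `f x` to the sphere.
  let D : E → ℝ := fun x => inner ℝ x (u x) ^ 2 + ‖u x‖ ^ 2 * (R ^ 2 - ‖x‖ ^ 2)
  let l : E → ℝ := fun x => (-inner ℝ x (u x) + √(D x)) / ‖u x‖ ^ 2
  -- For `‖x‖ = R`, `‖f x‖ ≤ R` gives `‖u x‖ ^ 2 ≤ 2 ⟪x, u x⟫`. This makes `D` positive on the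
  -- sphere, so `√D` is smooth there, and makes `l` vanish there.
  have hsphere : ∀ x, ‖x‖ = R → 0 < inner ℝ x (u x) := by
    intro x hx
    have h1 : ‖u x‖ ^ 2 = ‖x‖ ^ 2 - 2 * inner ℝ x (f x) + ‖f x‖ ^ 2 := norm_sub_sq_real x (f x)
    have h2 : inner ℝ x (u x) = ‖x‖ ^ 2 - inner ℝ x (f x) := by
      rw [inner_sub_right, real_inner_self_eq_norm_sq]
    have h3 : ‖f x‖ ^ 2 ≤ R ^ 2 := by gcongr; exact hfR x
    rw [hx] at h1 h2
    linarith [hu0 x]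
  have hD : ∀ x ∈ Metric.closedBall (0 : E) R, 0 < D x := by
    intro x hx
    rw [mem_closedBall_zero_iff] at hx
    rcases hx.eq_or_lt with h | h
    · have := hsphere x h
      simp only [D, h, sub_self, mul_zero, add_zero]
      positivity
    · have : 0 < R ^ 2 - ‖x‖ ^ 2 := sub_pos.2 (by gcongr)
      have := mul_pos (hu0 x) this
      simp only [D]
      positivity
  have hb : ContDiff ℝ 1 fun x => inner ℝ x (u x) := contDiff_id.inner ℝ hu
  have hDc : ContDiff ℝ 1 D :=
    (hb.pow 2).add ((hu.norm_sq ℝ).mul (contDiff_const.sub (contDiff_id.norm_sq ℝ)))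
  have hl : ContDiffOn ℝ 1 l (Metric.closedBall 0 R) :=
    (hb.neg.contDiffOn.add (hDc.contDiffOn.sqrt fun x hx => (hD x hx).ne')).div
      (hu.norm_sq ℝ).contDiffOn fun x _ => (hu0 x).ne'
  refine not_contDiffOn_retraction_sphere hR (r := fun x => x + l x • u x)
    (contDiffOn_id.add (hl.smul hu.contDiffOn)) (fun x hx => ?_) (fun x hx => ?_)
  · have h1 : ‖x + l x • u x‖ ^ 2 = R ^ 2 := by
      rw [norm_add_sq_real, inner_smul_right, norm_smul, mul_pow, Real.norm_eq_abs, sq_abs]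
      have h2 : √(D x) ^ 2 = D x := Real.sq_sqrt (hD x hx).le
      have h3 : l x * ‖u x‖ ^ 2 + inner ℝ x (u x) = √(D x) := by
        simp only [l]
        rw [div_mul_cancel₀ _ (hu0 x).ne']
        ring
      have h4 : ‖u x‖ ^ 2 * (‖x‖ ^ 2 + 2 * (l x * inner ℝ x (u x)) + l x ^ 2 * ‖u x‖ ^ 2)
          = ‖u x‖ ^ 2 * R ^ 2 := by
        rw [← h3] at h2
        simp only [D] at h2
        linear_combination h2
      exact mul_left_cancel₀ (hu0 x).ne' h4
    exact (sq_eq_sq₀ (norm_nonneg _) hR.le).1 h1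
  · rw [mem_sphere_zero_iff_norm] at hx
    have : l x = 0 := by
      simp [l, D, hx, Real.sqrt_sq (hsphere x hx).le]
    simp [this]

/-- Brouwer's fixed point theorem for continuous maps of the whole space into a ball. -/
theorem exists_fixedPoint_of_continuous_of_norm_le {R : ℝ} (hR : 0 < R) {f : E → E}
    (hf : Continuous f) (hfR : ∀ x, ‖f x‖ ≤ R) : ∃ x, f x = x := by
  by_contra! hne
  obtain ⟨x₀, -, hx₀⟩ := (isCompact_closedBall (0 : E) R).exists_isMinOn
    (Metric.nonempty_closedBall.2 hR.le)
    (f := fun x => ‖f x - x‖) (hf.sub continuous_id).norm.continuousOn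
  have hδ : 0 < ‖f x₀ - x₀‖ := norm_pos_iff.2 (sub_ne_zero.2 (hne x₀))
  -- A C¹ map into the ball, closer to `f` than the least displacement of `f` there; a fixed point
  -- of `g` would be displaced too little by `f`.
  obtain ⟨g, hg⟩ := exists_contMDiffMap_forall_mem_convex_of_local_const (n := 1)
    (modelWithCornersSelf ℝ E)
    (t := fun x => Metric.ball (f x) ‖f x₀ - x₀‖ ∩ Metric.closedBall 0 R)
    (fun x => (convex_ball _ _).inter (convex_closedBall _ _)) (fun x => ⟨f x, by
      filter_upwards [hf.continuousAt.eventually (Metric.ball_mem_nhds (f x) hδ)] with y hy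
      exact ⟨Metric.mem_ball_comm.1 hy, mem_closedBall_zero_iff.2 (hfR x)⟩⟩)
  obtain ⟨y, hy⟩ := exists_fixedPoint_of_contDiff_of_norm_le hR g.contMDiff.contDiff
    (fun x => mem_closedBall_zero_iff.1 (hg x).2)
  have h1 := (hg y).1
  have h2 := (hg y).2
  rw [hy] at h1 h2
  rw [Metric.mem_ball, dist_comm, dist_eq_norm] at h1
  exact absurd h1 (not_lt.2 (hx₀ h2))

/-- Brouwer's fixed point theorem for a compact convex set. -/
theorem IsCompact.exists_fixedPoint_of_continuousOn {K : Set E} (hK : IsCompact K)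
    (hne : K.Nonempty) (hc : Convex ℝ K) {f : E → E} (hf : ContinuousOn f K)
    (hfK : MapsTo f K K) : ∃ x ∈ K, f x = x := by
  obtain ⟨P, hPL, hPK, hPid, -⟩ := exists_lipschitzWith_one_projection hne hK.isClosed hc
  obtain ⟨R, hR, hKR⟩ := hK.isBounded.exists_pos_norm_le
  obtain ⟨x, hx⟩ := exists_fixedPoint_of_continuous_of_norm_le hR
    (hf.comp_continuous hPL.continuous hPK) (fun x => hKR _ (hfK (hPK x)))
  have hxK : x ∈ K := hx ▸ hfK (hPK x)
  exact ⟨x, hxK, by rwa [Function.comp_apply, hPid x hxK] at hx⟩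

end Brouwer

end BrouwerFixedPoint

/-! ### Variational inequalities -/

namespace VI

variable {m : ℕ} {G : EuclideanSpace ℝ (Fin m) → EuclideanSpace ℝ (Fin m)}
  {K : Set (EuclideanSpace ℝ (Fin m))}

/-- The Hartman–Stampacchia theorem: a continuous map on a nonempty compact convex set has a
solution of its variational inequality. -/
theorem solutionSet_nonempty_of_isCompact (hne : K.Nonempty) (hK : IsCompact K)
    (hc : Convex ℝ K) (hG : ContinuousOn G K) : (solutionSet G K).Nonempty := by
  obtain ⟨P, hPL, hPK, -, hPvi⟩ := exists_lipschitzWith_one_projection hne hK.isClosed hc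
  obtain ⟨y, hy, hfix⟩ := hK.exists_fixedPoint_of_continuousOn hne hc
    (hPL.continuous.comp_continuousOn (continuousOn_id.sub hG)) (fun x _ => hPK _)
  refine ⟨y, hy, fun v hv => ?_⟩
  have h := hPvi (y - G y) v hv
  have hfix' : P (y - G y) = y := hfix
  rw [hfix', sub_sub_cancel_left, inner_neg_left, real_inner_comm] at h
  linarith

theorem StronglyMonotoneOn.strictlyMonotoneOn (h : StronglyMonotoneOn G K) :
    StrictlyMonotoneOn G K := by
  obtain ⟨c, hc, h⟩ := h
  intro u hu v hv huv
  have : 0 < ‖u - v‖ := norm_pos_iff.2 (sub_ne_zero.2 huv)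
  exact lt_of_lt_of_le (by positivity) (h u hu v hv)

theorem StrictlyMonotoneOn.solutionSet_subsingleton (h : StrictlyMonotoneOn G K) :
    (solutionSet G K).Subsingleton := by
  rintro u ⟨hu, hu'⟩ v ⟨hv, hv'⟩
  by_contra huv
  have h1 := h u hu v hv huv
  have h2 := hu' v hv
  have h3 := hv' u hu
  rw [← neg_sub, inner_neg_left] at h2
  rw [inner_sub_right] at h1
  linarith

/-- A solution on the truncation of `K` by a ball that lies inside the open ball solves the
variational inequality on `K`. -/
theorem mem_solutionSet_of_mem_solutionSet_inter_closedBall (hc : Convex ℝ K)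
    {x y : EuclideanSpace ℝ (Fin m)} {R : ℝ} (hy : y ∈ solutionSet G (K ∩ Metric.closedBall x R))
    (hyR : y ∈ Metric.ball x R) : y ∈ solutionSet G K := by
  refine ⟨hy.1.1, fun v hv => ?_⟩
  have hcont : Filter.Tendsto (fun s : ℝ => y + s • (v - y)) (nhdsWithin 0 (Set.Ioi 0))
      (nhds y) := by
    have : Continuous fun s : ℝ => y + s • (v - y) := by fun_prop
    simpa using (this.tendsto 0).mono_left nhdsWithin_le_nhds
  obtain ⟨s, ⟨hs, hs1⟩, hs0⟩ := (((hcont.eventually (Metric.isOpen_ball.mem_nhds hyR)).and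
    (nhdsWithin_le_nhds (Iio_mem_nhds one_pos))).and self_mem_nhdsWithin).exists
  have h := hy.2 _ ⟨hc.add_smul_sub_mem hy.1.1 hv ⟨le_of_lt hs0, le_of_lt hs1⟩,
    Metric.ball_subset_closedBall hs⟩
  rw [add_sub_cancel_left, real_inner_smul_left] at h
  exact nonneg_of_mul_nonneg_right h hs0

/-- Testing a truncated solution `y` against the centre `x` gives `c ‖y - x‖ ^ 2 ≤ ‖y - x‖ ‖G x‖`,
so `‖y - x‖ ≤ ‖G x‖ / c`; the extra `1` in the radius makes `y` interior to the ball. -/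
theorem StronglyMonotoneOn.solutionSet_nonempty (hne : K.Nonempty) (hK : IsClosed K)
    (hc : Convex ℝ K) (hG : ContinuousOn G K) (h : StronglyMonotoneOn G K) :
    (solutionSet G K).Nonempty := by
  obtain ⟨c, hc0, h⟩ := h
  obtain ⟨x, hx⟩ := hne
  have hR : 0 < ‖G x‖ / c + 1 := by positivity
  obtain ⟨y, hy⟩ := solutionSet_nonempty_of_isCompact (G := G)
    (K := K ∩ Metric.closedBall x (‖G x‖ / c + 1)) ⟨x, hx, Metric.mem_closedBall_self hR.le⟩
    ((isCompact_closedBall _ _).inter_left hK) (hc.inter (convex_closedBall _ _))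
    (hG.mono Set.inter_subset_left)
  refine ⟨y, mem_solutionSet_of_mem_solutionSet_inter_closedBall hc hy ?_⟩
  have h1 := hy.2 x ⟨hx, Metric.mem_closedBall_self hR.le⟩
  have h2 := h y hy.1.1 x hx
  have h3 := real_inner_le_norm (x - y) (G x)
  rw [norm_sub_rev] at h3
  have h4 : c * ‖y - x‖ ^ 2 ≤ ‖y - x‖ * ‖G x‖ := by
    rw [← neg_sub x y, norm_neg, inner_neg_left, inner_sub_right, norm_sub_rev] at h2
    linarith
  rw [Metric.mem_ball, dist_eq_norm]
  refine lt_of_le_of_lt ?_ (lt_add_one _)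
  rw [le_div_iff₀ hc0]
  by_contra! hlt
  have : 0 < ‖y - x‖ := by
    by_contra! h0
    nlinarith [norm_nonneg (G x), norm_nonneg (y - x)]
  nlinarith

/-- On an unbounded set some linear functional has no minimum. -/
theorem exists_const_solutionSet_eq_empty (hK : ¬ Bornology.IsBounded K) :
    ∃ w : EuclideanSpace ℝ (Fin m), solutionSet (fun _ => w) K = ∅ := by
  by_contra! hall
  refine hK ?_
  have hcoord : ∀ i : Fin m, ∃ C : ℝ, ∀ v ∈ K, |v i| ≤ C := by
    intro i
    -- `a` minimizes the `i`-th coordinate on `K`, and `b` maximizes it.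
    obtain ⟨a, -, ha⟩ := hall (EuclideanSpace.single i 1)
    obtain ⟨b, -, hb⟩ := hall (EuclideanSpace.single i (-1))
    refine ⟨|a i| + |b i|, fun v hv => ?_⟩
    have h1 := ha v hv
    have h2 := hb v hv
    simp [EuclideanSpace.inner_single_right] at h1 h2
    rw [abs_le]
    constructor <;> linarith [neg_abs_le (a i), le_abs_self (b i), abs_nonneg (a i),
      abs_nonneg (b i)]
  choose C hC using hcoord
  refine isBounded_iff_forall_norm_le.2 ⟨√(∑ i, C i ^ 2), fun v hv => ?_⟩
  rw [EuclideanSpace.norm_eq]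
  gcongr with i
  exact hC i v hv

end VI

theorem mainTheorem2 (m : ℕ) (K : Set (EuclideanSpace ℝ (Fin m)))
    (hne : K.Nonempty) (hclosed : IsClosed K) (hconv : Convex ℝ K) :
    (∀ G : EuclideanSpace ℝ (Fin m) → EuclideanSpace ℝ (Fin m), ContinuousOn G K →
      (IsCompact K → (VI.solutionSet G K).Nonempty) ∧
      (IsCompact K → VI.StrictlyMonotoneOn G K → ∃! y, y ∈ VI.solutionSet G K) ∧
      (VI.StronglyMonotoneOn G K → ∃! y, y ∈ VI.solutionSet G K)) ∧
    (¬ Bornology.IsBounded K →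
      ∃ G : EuclideanSpace ℝ (Fin m) → EuclideanSpace ℝ (Fin m),
        ContinuousOn G K ∧ VI.solutionSet G K = ∅) := by
  refine ⟨fun G hG => ⟨fun hK => VI.solutionSet_nonempty_of_isCompact hne hK hconv hG,
    fun hK hmono => ?_, fun hmono => ?_⟩, fun hK => ?_⟩
  · obtain ⟨y, hy⟩ := VI.solutionSet_nonempty_of_isCompact hne hK hconv hG
    exact ⟨y, hy, fun z hz => hmono.solutionSet_subsingleton hz hy⟩
  · obtain ⟨y, hy⟩ := hmono.solutionSet_nonempty hne hclosed hconv hG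
    exact ⟨y, hy, fun z hz => hmono.strictlyMonotoneOn.solutionSet_subsingleton hz hy⟩
  · obtain ⟨w, hw⟩ := VI.exists_const_solutionSet_eq_empty hK
    exact ⟨fun _ => w, continuousOn_const, hw⟩
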